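/- Let $n\ge 0$ and let $C\subseteq\mathbb{R}^n$ be a nonempty open convex cone. A smooth function $f\colon C\to\mathbb{R}$ is called completely monotone on $C$ if $(-1)^r D_{v_1}\cdots D_{v_r}f(x)\ge 0$ for all $r\ge 0$, all $v_1,\dots,v_r\in C$ and all $x\in C$, where $D_v$ denotes the directional derivative along $v$. A homogeneous polynomial $p\in\mathbb{R}[x_1,\dots,x_n]$ is called hyperbolic with respect to $e\in\mathbb{R}^n$ if $p(e)>0$ and, for every $x\in\mathbb{R}^n$, the univariate polynomial $t\mapsto p(te+x)$ has only real zeros; the corresponding hyperbolicity cone is the connected component of $\{x\in\mathbb{R}^n : p(x)\neq 0\}$ that contains $e$. The polynomial $p$ is called hyperbolic if it is hyperbolic with respect to some $e\in\mathbb{R}^n$. **Theorem.** Let $p,q\in\mathbb{R}[x_1,\dots,x_n]$ be homogeneous polynomials without a nonconstant common factor, both positive at every point of $C$, and suppose that $f=(q/p)^\alpha$ is completely monotone on $C$ for some real $\alpha>0$. Then $p$ is hyperbolic and its hyperbolicity cone contains $C$; precisely, for every $e\in C$, the polynomial $p$ is hyperbolic with respect to $e$ and the hyperbolicity cone of $p$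 with respect to $e$ contains $C$. -/

import Mathlib

open scoped ContDiff

/-- A function `f` is completely monotone on the open convex cone `C ⊆ ℝⁿ`: it is smooth on `C` and
`(-1)^r D_{v₁} ⋯ D_{v_r} f (x) ≥ 0` for all `r ≥ 0`, all directions `v₁, …, v_r ∈ C` and all
`x ∈ C`. As `C` is open and `f` is smooth on it, the `r`-th Fréchet derivative at `x` applied to
`(v₁, …, v_r)` is the iterated directional derivative, and values of `f` off `C` play no role. -/
def IsCompletelyMonotoneOn {n : ℕ} (f : (Fin n → ℝ) → ℝ) (C : Set (Fin n → ℝ)) : Prop :=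
  ContDiffOn ℝ ∞ f C ∧
    ∀ (r : ℕ) (v : Fin r → (Fin n → ℝ)), (∀ i, v i ∈ C) → ∀ x ∈ C,
      0 ≤ (-1 : ℝ) ^ r * iteratedFDeriv ℝ r f x v

/-- A polynomial `p ∈ ℝ[x₁, …, xₙ]` is hyperbolic with respect to `e ∈ ℝⁿ`: it is homogeneous,
`p(e) > 0`, and for every `x ∈ ℝⁿ` all complex zeros of `t ↦ p(t e + x)` are real. -/
structure IsHyperbolicWrt {n : ℕ} (p : MvPolynomial (Fin n) ℝ) (e : Fin n → ℝ) : Prop where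
  isHomogeneous : ∃ d : ℕ, p.IsHomogeneous d
  pos : 0 < MvPolynomial.eval e p
  real_zeros : ∀ (x : Fin n → ℝ) (t : ℂ),
    MvPolynomial.aeval (fun i => t * (e i : ℂ) + (x i : ℂ)) p = 0 → t.im = 0

/-- A polynomial is hyperbolic if it is hyperbolic with respect to some vector. -/
def IsHyperbolic {n : ℕ} (p : MvPolynomial (Fin n) ℝ) : Prop :=
  ∃ e : Fin n → ℝ, IsHyperbolicWrt p e

/-- The hyperbolicity cone of `p` with respect to `e`: the connected component of
`ℝⁿ \ V(p)` that contains `e`. -/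
def hyperbolicityCone {n : ℕ} (p : MvPolynomial (Fin n) ℝ) (e : Fin n → ℝ) : Set (Fin n → ℝ) :=
  connectedComponentIn {x | MvPolynomial.eval x p ≠ 0} e

open Filter Topology

/-! It suffices that `p` has no zero `z` in the tube `C + iℝⁿ`: by homogeneity, a nonreal zero of `t
↦ p(te + x)` rescales to such a `z` with real part `e`.

Suppose first `q(z) ≠ 0`. With `e = Re z`, write `z = 2N e + c₀ v₀ + c₁ v₁`, where `v₀, v₁ ∈ C` and
`|c₀| = |c₁| < N`. The Taylor coefficients of `f` at `2N e` in direction `∑ cⱼ vⱼ` are polynomials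
in `c`, and by complete monotonicity all contributions of degree `r` carry the sign `(-1)^r`.
Replacing `cⱼ` by `|cⱼ|` thus dominates them by coefficients along the ray through `e`, and Taylor's
formula bounds these. So the series converges to some `g` on a disc of radius greater than `1`. With
`P`, `Q` the restrictions of `p`, `q` to the complex line, `g` satisfies `P Q g' = α (Q' P - P' Q)
g`, because this holds formally for real `c`. A zero of `P` of order `a > 0` at `1`, where `g`
vanishes to order `m ≥ 0`, would force `m + αa = 0` (`eval_ne_zero_of_ode`).

Zeros common to `p` and `q` are handled by approximation: as `p` and `q` have no common factor,
elimination shows that every zero of `p` is a limit of zeros of `p` off `q = 0`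
(`exists_zero_ne_zero_near`), and the tube is open. -/

/-- The polynomial `T ↦ p(a + T b)` with coefficients in an `ℝ`-algebra `R`. -/
noncomputable def MvPolynomial.lineRestrict {σ R : Type*} [CommRing R] [Algebra ℝ R]
    (p : MvPolynomial σ ℝ) (a b : σ → R) : Polynomial R :=
  MvPolynomial.aeval (fun i => Polynomial.C (a i) + Polynomial.X * Polynomial.C (b i)) p

/-! ### Restriction of homogeneous polynomials to lines. -/

namespace MvPolynomial

variable {σ R S : Type*} [CommRing R] [Algebra ℝ R] [CommRing S] [Algebra ℝ S]

theorem eval_lineRestrict (p : MvPolynomial σ ℝ) (a b : σ → R) (t : R) :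
    (p.lineRestrict a b).eval t = aeval (fun i => a i + t * b i) p := by
  have h : ((Polynomial.aeval t : Polynomial R →ₐ[R] R).restrictScalars ℝ).comp
      (aeval (fun i => Polynomial.C (a i) + Polynomial.X * Polynomial.C (b i))) =
      aeval (fun i => a i + t * b i) := by
    ext i
    simp only [AlgHom.coe_comp, Function.comp_apply, aeval_X]
    simp [mul_comm t]
  have := DFunLike.congr_fun h p
  simpa [lineRestrict, Polynomial.coe_aeval_eq_eval] using this

theorem map_lineRestrict (φ : R →ₐ[ℝ] S) (p : MvPolynomial σ ℝ) (a b : σ → R) :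
    (p.lineRestrict a b).map (φ : R →+* S) = p.lineRestrict (φ ∘ a) (φ ∘ b) := by
  have h : (Polynomial.mapAlgHom φ).comp
      (aeval (fun i => Polynomial.C (a i) + Polynomial.X * Polynomial.C (b i))) =
      aeval (fun i => Polynomial.C ((φ ∘ a) i) + Polynomial.X * Polynomial.C ((φ ∘ b) i)) := by
    ext i
    simp
  exact DFunLike.congr_fun h p

theorem natDegree_prod_line_le_and_coeff {R : Type*} [CommRing R] (a b : σ → R) (m : σ → ℕ) (s : Finset σ) :
    (∏ i ∈ s, (Polynomial.C (a i) + Polynomial.X * Polynomial.C (b i)) ^ m i).natDegree ≤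
        ∑ i ∈ s, m i ∧
      (∏ i ∈ s, (Polynomial.C (a i) + Polynomial.X * Polynomial.C (b i)) ^ m i).coeff
        (∑ i ∈ s, m i) = ∏ i ∈ s, b i ^ m i := by
  classical
  have h1 : ∀ i, (Polynomial.C (a i) + Polynomial.X * Polynomial.C (b i)).natDegree ≤ 1 := by
    intro i
    compute_degree
  have h2 : ∀ i, ((Polynomial.C (a i) + Polynomial.X * Polynomial.C (b i)) ^ m i).natDegree
      ≤ m i := by
    intro i
    simpa using Polynomial.natDegree_pow_le_of_le (m i) (h1 i)
  induction s using Finset.induction_on with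
  | empty => simp
  | insert i s hi ih =>
    rw [Finset.prod_insert hi, Finset.sum_insert hi, Finset.prod_insert hi]
    refine ⟨Polynomial.natDegree_mul_le_of_le (h2 i) ih.1, ?_⟩
    rw [Polynomial.coeff_mul_add_eq_of_natDegree_le (h2 i) ih.1, ih.2]
    have := Polynomial.coeff_pow_of_natDegree_le (m := m i) (h1 i)
    rw [mul_one] at this
    rw [this]
    simp [Polynomial.coeff_C]

theorem sum_support_of_isHomogeneous {p : MvPolynomial σ ℝ} {d : ℕ} (hp : p.IsHomogeneous d)
    {m : σ →₀ ℕ} (hm : m ∈ p.support) : ∑ i ∈ m.support, m i = d := by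
  have := hp (mem_support_iff.1 hm)
  rw [← this, Finsupp.weight_apply, Finsupp.sum]
  simp

/-- The top coefficient does not depend on the base point `a`, so in a direction with `p(b) ≠ 0` the
restriction is monic up to a constant. -/
theorem natDegree_lineRestrict_le_and_coeff {p : MvPolynomial σ ℝ} {d : ℕ}
    (hp : p.IsHomogeneous d) (a b : σ → R) :
    (p.lineRestrict a b).natDegree ≤ d ∧ (p.lineRestrict a b).coeff d = aeval b p := by
  rw [lineRestrict, aeval_def, aeval_def, eval₂_eq, eval₂_eq]
  constructor
  · refine Polynomial.natDegree_sum_le_of_forall_le _ _ fun m hm => ?_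
    refine (Polynomial.natDegree_C_mul_le _ _).trans ?_
    rw [← sum_support_of_isHomogeneous hp hm]
    exact (natDegree_prod_line_le_and_coeff a b m _).1
  · rw [Polynomial.finsetSum_coeff]
    refine Finset.sum_congr rfl fun m hm => ?_
    rw [show algebraMap ℝ (Polynomial R) (p.coeff m) = Polynomial.C (algebraMap ℝ R (p.coeff m))
      from rfl, Polynomial.coeff_C_mul, ← sum_support_of_isHomogeneous hp hm,
      (natDegree_prod_line_le_and_coeff a b m _).2]

/-- A zero close to `0` of `τ ↦ p(z + τ e)`, if `p(z)` is small. -/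
theorem exists_zero_of_norm_aeval_lt {p : MvPolynomial σ ℝ} {d : ℕ} (hp : p.IsHomogeneous d)
    {z e : σ → ℂ} (he : aeval e p ≠ 0) {ε : ℝ} (hε : 0 < ε)
    (hz : ‖aeval z p‖ < ‖aeval e p‖ * ε ^ d) :
    ∃ τ : ℂ, ‖τ‖ < ε ∧ aeval (fun i => z i + τ * e i) p = 0 := by
  obtain ⟨h1, h2⟩ := natDegree_lineRestrict_le_and_coeff hp z e
  set P := p.lineRestrict z e with hP
  have hdeg : P.natDegree = d :=
    le_antisymm h1 (Polynomial.le_natDegree_of_ne_zero (by rw [h2]; exact he))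
  have hlead : P.leadingCoeff = aeval e p := by rw [Polynomial.leadingCoeff, hdeg, h2]
  have hs := IsAlgClosed.splits P
  have hcard : P.roots.card = d := by rw [← hdeg]; exact hs.natDegree_eq_card_roots.symm
  have h0 : P.eval 0 = aeval z p := by rw [hP, eval_lineRestrict]; simp
  by_contra! hcon
  have hroots : ∀ τ ∈ P.roots, ε ≤ ‖τ‖ := by
    intro τ hτ
    by_contra! hlt
    refine hcon τ hlt ?_
    rw [← eval_lineRestrict]
    exact Polynomial.isRoot_of_mem_roots hτ
  -- Were all `d` roots of norm at least `ε`, then `P(0)`, which is `p(e)` times a product over the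
  -- roots, would have norm at least `‖p(e)‖ ε^d`.
  have hprod : ∀ s : Multiset ℂ, (∀ τ ∈ s, ε ≤ ‖τ‖) →
      ε ^ s.card ≤ ‖(s.map (fun a => (0 : ℂ) - a)).prod‖ := by
    intro s
    induction s using Multiset.induction_on with
    | empty => simp
    | cons a s ih =>
      intro h
      rw [Multiset.map_cons, Multiset.prod_cons, norm_mul, Multiset.card_cons, pow_succ']
      refine mul_le_mul ?_ (ih fun τ hτ => h τ (Multiset.mem_cons_of_mem hτ)) (by positivity)
        (norm_nonneg _)
      simpa using h a (Multiset.mem_cons_self a s)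
  have := hprod _ hroots
  rw [hcard] at this
  have h3 := hs.eval_eq_prod_roots 0
  rw [h0, hlead] at h3
  rw [h3, norm_mul] at hz
  exact absurd (lt_of_mul_lt_mul_left hz (norm_nonneg _)) (not_lt.2 this)

/-! ### Elimination of one variable. -/

/-- The substitution `X ↦ X + T e` of the polynomial ring in the variables `X` and `T`. -/
noncomputable def shiftHom (e : σ → ℝ) :
    Polynomial (MvPolynomial σ ℝ) →+* Polynomial (MvPolynomial σ ℝ) :=
  Polynomial.eval₂RingHom
    ((aeval (fun i => Polynomial.C (X i) + Polynomial.X * Polynomial.C (C (e i))) :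
      MvPolynomial σ ℝ →ₐ[ℝ] Polynomial (MvPolynomial σ ℝ)) :
      MvPolynomial σ ℝ →+* Polynomial (MvPolynomial σ ℝ)) Polynomial.X

theorem shiftHom_C (e : σ → ℝ) (p : MvPolynomial σ ℝ) :
    shiftHom e (Polynomial.C p) = p.lineRestrict X (fun i => C (e i)) := by
  simp [shiftHom, lineRestrict]

theorem shiftHom_X (e : σ → ℝ) : shiftHom e Polynomial.X = Polynomial.X := by
  simp [shiftHom]

theorem shiftHom_C_C (e : σ → ℝ) (c : ℝ) :
    shiftHom e (Polynomial.C (C c)) = Polynomial.C (C c) := by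
  rw [shiftHom_C, lineRestrict, aeval_C]
  rfl

theorem shiftHom_C_X (e : σ → ℝ) (i : σ) :
    shiftHom e (Polynomial.C (X i)) =
      Polynomial.C (X i) + Polynomial.X * Polynomial.C (C (e i)) := by
  rw [shiftHom_C, lineRestrict, aeval_X]

theorem shiftHom_neg_shiftHom (e e' : σ → ℝ) (he : ∀ i, e' i = -e i)
    (F : Polynomial (MvPolynomial σ ℝ)) : shiftHom e' (shiftHom e F) = F := by
  have : (shiftHom e').comp (shiftHom e) = RingHom.id _ := by
    apply Polynomial.ringHom_ext'
    · apply MvPolynomial.ringHom_ext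
      · intro r
        simp [shiftHom_C_C]
      · intro i
        simp only [RingHom.coe_comp, Function.comp_apply, shiftHom_C_C, shiftHom_C_X, shiftHom_X,
          he, map_add, map_mul, map_neg, RingHom.id_apply]
        ring
    · simp [shiftHom_X]
  exact DFunLike.congr_fun this F

/-- `shiftHom e` is an automorphism with inverse `shiftHom (-e)`. A common divisor pulls back to a
divisor of the constants `p` and `q` in `T`, hence to a constant, which is a unit by coprimality. -/
theorem isRelPrime_lineRestrict {p q : MvPolynomial σ ℝ} (hpq : IsRelPrime p q) (hp : p ≠ 0)
    (e : σ → ℝ) :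
    IsRelPrime (p.lineRestrict X fun i => (C (e i) : MvPolynomial σ ℝ))
      (q.lineRestrict X fun i => C (e i)) := by
  intro D hDP hDQ
  rw [← shiftHom_C] at hDP hDQ
  have e1 := map_dvd (shiftHom fun i => -e i) hDP
  have e2 := map_dvd (shiftHom fun i => -e i) hDQ
  rw [shiftHom_neg_shiftHom e _ fun _ => rfl] at e1 e2
  have e3 : (shiftHom (fun i => -e i) D).natDegree = 0 := by
    have := Polynomial.natDegree_le_of_dvd e1 (by simpa using hp)
    simpa using this
  obtain ⟨δ, hδ⟩ := Polynomial.natDegree_eq_zero.1 e3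
  rw [← hδ] at e1 e2
  have hu : IsUnit δ := hpq (by simpa using (Polynomial.C_dvd_iff_dvd_coeff _ _).1 e1 0)
    (by simpa using (Polynomial.C_dvd_iff_dvd_coeff _ _).1 e2 0)
  have := (hu.map (Polynomial.C : MvPolynomial σ ℝ →+* _)).map (shiftHom e)
  rwa [hδ, shiftHom_neg_shiftHom _ e fun _ => (neg_neg _).symm] at this

/-- A monic polynomial over an integrally closed domain that has no common factor with `Q` is
coprime to `Q` over the field of fractions. -/
theorem _root_.Polynomial.isCoprime_map_of_isRelPrime {R : Type*} [CommRing R] [IsDomain R]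
    [IsIntegrallyClosed R] (K : Type*) [Field K] [Algebra R K] [IsFractionRing R K]
    {P Q : Polynomial R} (hP : P.Monic) (hPQ : IsRelPrime P Q) :
    IsCoprime (P.map (algebraMap R K)) (Q.map (algebraMap R K)) := by
  have hinj : Function.Injective (algebraMap R K) := IsFractionRing.injective R K
  refine IsRelPrime.isCoprime fun D hDP hDQ => ?_
  -- Gauss's lemma: up to a constant, a divisor over `K` of a monic polynomial already has
  -- coefficients in `R`.
  obtain ⟨g, hg⟩ := IsIntegrallyClosed.eq_map_mul_C_of_dvd K hP hDP
  have hD0 : D ≠ 0 := by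
    rintro rfl
    exact (hP.map (algebraMap R K)).ne_zero (zero_dvd_iff.1 hDP)
  have hlu : IsUnit (Polynomial.C D.leadingCoeff) := by
    rw [Polynomial.isUnit_C]
    exact isUnit_iff_ne_zero.2 (Polynomial.leadingCoeff_ne_zero.2 hD0)
  have hgm : g.Monic := by
    refine Polynomial.monic_of_injective hinj ?_
    have := congrArg Polynomial.leadingCoeff hg
    rw [Polynomial.leadingCoeff_mul, Polynomial.leadingCoeff_C] at this
    exact mul_right_cancel₀ (Polynomial.leadingCoeff_ne_zero.2 hD0) (by rw [this, one_mul])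
  have hgD : g.map (algebraMap R K) ∣ D := ⟨_, hg.symm⟩
  have hgu := hPQ ((Polynomial.map_dvd_map _ hinj hgm).1 (hgD.trans hDP))
    ((Polynomial.map_dvd_map _ hinj hgm).1 (hgD.trans hDQ))
  rw [← hg]
  exact (hgu.map (Polynomial.mapRingHom (algebraMap R K))).mul hlu

/-- Clear denominators in a Bézout identity over the fraction field; `h` is the product of the two
denominators. -/
theorem _root_.Polynomial.exists_bezout_of_isRelPrime {R : Type*} [CommRing R] [IsDomain R]
    [IsIntegrallyClosed R] {P Q : Polynomial R} (hP : P.Monic) (hPQ : IsRelPrime P Q) :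
    ∃ (A B : Polynomial R) (h : R), h ≠ 0 ∧ A * P + B * Q = Polynomial.C h := by
  let K := FractionRing R
  obtain ⟨A, B, hAB⟩ := Polynomial.isCoprime_map_of_isRelPrime K hP hPQ
  obtain ⟨a, ha0, ha⟩ := IsLocalization.integerNormalization_spec (nonZeroDivisors R) A
  obtain ⟨b, hb0, hb⟩ := IsLocalization.integerNormalization_spec (nonZeroDivisors R) B
  refine ⟨Polynomial.C b * IsLocalization.integerNormalization (nonZeroDivisors R) A,
    Polynomial.C a * IsLocalization.integerNormalization (nonZeroDivisors R) B,
    a * b, mul_ne_zero (nonZeroDivisors.ne_zero ha0) (nonZeroDivisors.ne_zero hb0), ?_⟩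
  apply Polynomial.map_injective _ (IsFractionRing.injective R K)
  have hsm : ∀ (c : R) (F : Polynomial K), c • F = Polynomial.C (algebraMap R K c) * F := by
    intro c F
    rw [← Polynomial.smul_eq_C_mul, algebraMap_smul]
  simp only [Polynomial.map_add, Polynomial.map_mul, Polynomial.map_C, ha, hb, map_mul, hsm]
  linear_combination (Polynomial.C (algebraMap R K a) * Polynomial.C (algebraMap R K b)) * hAB

/-- If `p` and `q` have no common factor, elimination of the variable `T` from `p(X + T e)` and
`q(X + T e)` yields a nonzero polynomial. -/
theorem exists_elimination {p q : MvPolynomial σ ℝ} (hpq : IsRelPrime p q) {d : ℕ}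
    (hp : p.IsHomogeneous d) {e : σ → ℝ} (he : eval e p ≠ 0) :
    ∃ (A B : Polynomial (MvPolynomial σ ℝ)) (h : MvPolynomial σ ℝ), h ≠ 0 ∧
      A * p.lineRestrict X (fun i => C (e i)) + B * q.lineRestrict X (fun i => C (e i)) =
        Polynomial.C h := by
  have hp0 : p ≠ 0 := by rintro rfl; simp at he
  obtain ⟨h1, h2⟩ := natDegree_lineRestrict_le_and_coeff hp (X : σ → MvPolynomial σ ℝ)
    (fun i => C (e i))
  have h2' : aeval (fun i => (C (e i) : MvPolynomial σ ℝ)) p = C (eval e p) :=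
    aeval_algebraMap_apply (MvPolynomial σ ℝ) e p
  have hunit : (C (eval e p)⁻¹ : MvPolynomial σ ℝ) * C (eval e p) = 1 := by
    rw [← C_mul, inv_mul_cancel₀ he, C_1]
  have hM : (Polynomial.C (C (eval e p)⁻¹) *
      p.lineRestrict X (fun i => (C (e i) : MvPolynomial σ ℝ))).Monic := by
    refine Polynomial.monic_of_natDegree_le_of_coeff_eq_one d
      ((Polynomial.natDegree_C_mul_le _ _).trans h1) ?_
    rw [Polynomial.coeff_C_mul, h2, h2', hunit]
  have hu : IsUnit (Polynomial.C (C (eval e p)⁻¹ : MvPolynomial σ ℝ)) :=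
    (IsUnit.of_mul_eq_one _ hunit).map Polynomial.C
  obtain ⟨A, B, h, hh, hAB⟩ := Polynomial.exists_bezout_of_isRelPrime hM
    ((isRelPrime_mul_unit_left_left hu).2 (isRelPrime_lineRestrict hpq hp0 e))
  exact ⟨A * Polynomial.C (C (eval e p)⁻¹), B, h, hh, by rw [← hAB]; ring⟩

end MvPolynomial

/-! ### Density of the zeros of `p` at which `q` does not vanish. -/

namespace MvPolynomial

variable {σ : Type*}

theorem continuous_aeval_complex [Finite σ] (p : MvPolynomial σ ℝ) :
    Continuous fun z : σ → ℂ => aeval z p := by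
  have : (fun z : σ → ℂ => aeval z p) = fun z => eval z (map (algebraMap ℝ ℂ) p) := by
    funext z
    rw [eval_map, aeval_def]
  rw [this]
  exact MvPolynomial.continuous_eval _

theorem eventually_aeval_ne_zero_of_line {h : MvPolynomial σ ℝ} (hh : h ≠ 0) (z : σ → ℂ) :
    ∃ w : σ → ℂ, ∀ᶠ s : ℂ in 𝓝[≠] 0, aeval (fun i => z i + s * w i) h ≠ 0 := by
  obtain ⟨r, hr⟩ : ∃ r : σ → ℝ, eval r h ≠ 0 := by
    by_contra! hcon
    exact hh (MvPolynomial.funext fun x => by simpa using hcon x)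
  -- The line from `z` reaches the real point `r` at parameter `1`, where `h` does not vanish; so
  -- `h` has finitely many zeros on this line.
  refine ⟨fun i => (r i : ℂ) - z i, ?_⟩
  set F := h.lineRestrict z (fun i => (r i : ℂ) - z i) with hF
  have hF0 : F ≠ 0 := by
    intro h0
    have h1 : F.eval 1 = 0 := by rw [h0]; simp
    rw [hF, eval_lineRestrict] at h1
    have h2 : (fun i => z i + 1 * ((r i : ℂ) - z i)) = fun i => algebraMap ℝ ℂ (r i) := by
      funext i
      simp
    rw [h2] at h1
    have h3 : aeval (fun i => algebraMap ℝ ℂ (r i)) h = algebraMap ℝ ℂ (aeval r h) :=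
      aeval_algebraMap_apply ℂ r h
    rw [h3] at h1
    exact hr (by simpa [coe_aeval_eq_eval] using h1)
  have hfin : ({s | F.IsRoot s} \ {0}).Finite :=
    (Polynomial.finite_setOfPred_isRoot hF0).subset Set.sdiff_subset
  have hmem : ({s | F.IsRoot s} \ {0})ᶜ ∈ 𝓝 (0 : ℂ) := hfin.isClosed.isOpen_compl.mem_nhds (by simp)
  filter_upwards [nhdsWithin_le_nhds hmem, self_mem_nhdsWithin] with s hs hs0
  rw [← eval_lineRestrict]
  exact fun h => hs ⟨h, hs0⟩

/-- Every complex zero of `p` is a limit of zeros of `p` that are not zeros of `q`. -/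
theorem exists_zero_ne_zero_near [Finite σ] {p q : MvPolynomial σ ℝ} (hpq : IsRelPrime p q) {d : ℕ}
    (hp : p.IsHomogeneous d) {e : σ → ℝ} (he : eval e p ≠ 0) {z : σ → ℂ} (hz : aeval z p = 0)
    {U : Set (σ → ℂ)} (hU : U ∈ 𝓝 z) : ∃ z' ∈ U, aeval z' p = 0 ∧ aeval z' q ≠ 0 := by
  obtain ⟨A, B, h, hh, hAB⟩ := exists_elimination hpq hp he
  obtain ⟨w, hw⟩ := eventually_aeval_ne_zero_of_line hh z
  -- Evaluate `A p + B q = h` at `X = z'`, `T = τ`: since `h` does not involve `T`, `h(z') ≠ 0`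
  -- excludes common zeros on the whole line `z' + τ e`.
  have key : ∀ (z' : σ → ℂ) (τ : ℂ), aeval z' h ≠ 0 →
      aeval (fun i => z' i + τ * (e i : ℂ)) p = 0 →
      aeval (fun i => z' i + τ * (e i : ℂ)) q ≠ 0 := by
    intro z' τ hz' h1 h2
    have hl : ∀ r : MvPolynomial σ ℝ, Polynomial.eval₂
        ((aeval z' : MvPolynomial σ ℝ →ₐ[ℝ] ℂ) : MvPolynomial σ ℝ →+* ℂ) τ
        (r.lineRestrict X fun i => C (e i)) = aeval (fun i => z' i + τ * (e i : ℂ)) r := by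
      intro r
      rw [← Polynomial.eval_map, map_lineRestrict, eval_lineRestrict]
      congr 2
      funext i
      simp
    have := congrArg (Polynomial.eval₂
      ((aeval z' : MvPolynomial σ ℝ →ₐ[ℝ] ℂ) : MvPolynomial σ ℝ →+* ℂ) τ) hAB
    rw [Polynomial.eval₂_add, Polynomial.eval₂_mul, Polynomial.eval₂_mul, hl, hl, h1, h2,
      Polynomial.eval₂_C] at this
    exact hz' (by simpa using this.symm)
  have heC : aeval (fun i => (e i : ℂ)) p ≠ 0 := by
    have h3 : aeval (fun i => algebraMap ℝ ℂ (e i)) p = algebraMap ℝ ℂ (aeval e p) :=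
      aeval_algebraMap_apply ℂ e p
    intro h4
    exact he (by simpa [coe_aeval_eq_eval] using h3.symm.trans h4)
  have hcont : Tendsto (fun x : (σ → ℂ) × ℂ => fun i => x.1 i + x.2 * (e i : ℂ)) (𝓝 z ×ˢ 𝓝 0)
      (𝓝 z) := by
    rw [← nhds_prod_eq]
    have : Continuous (fun x : (σ → ℂ) × ℂ => fun i => x.1 i + x.2 * (e i : ℂ)) := by fun_prop
    simpa using this.tendsto (z, 0)
  obtain ⟨pa, hpa, pb, hpb, hab⟩ := eventually_prod_iff.1 (hcont.eventually hU)
  obtain ⟨ε, hε, hεb⟩ := Metric.eventually_nhds_iff.1 hpb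
  have hsmall : ∀ᶠ z' : σ → ℂ in 𝓝 z,
      ‖aeval z' p‖ < ‖aeval (fun i => (e i : ℂ)) p‖ * ε ^ d := by
    have hc := (continuous_aeval_complex p).norm.tendsto z
    simp only [hz, norm_zero] at hc
    exact hc.eventually (gt_mem_nhds (by positivity))
  have hline : Tendsto (fun s : ℂ => fun i => z i + s * w i) (𝓝[≠] 0) (𝓝 z) := by
    have : Continuous (fun s : ℂ => fun i => z i + s * w i) := by fun_prop
    refine Tendsto.mono_left ?_ nhdsWithin_le_nhds
    simpa using this.tendsto 0
  obtain ⟨s, ⟨hs1, hs2⟩, hs3⟩ := ((hline.eventually (hsmall.and hpa)).and hw).exists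
  obtain ⟨τ, hτ, hτ0⟩ := exists_zero_of_norm_aeval_lt hp heC hε hs1
  exact ⟨_, hab hs2 (hεb (by simpa using hτ)), hτ0, key _ τ hs3 hτ0⟩

end MvPolynomial

/-! ### Taylor series and first-order linear differential equations. -/

section TaylorSeries

variable {𝕜 : Type*} [NontriviallyNormedField 𝕜]

/-- The Taylor series at `0` of a function of one variable, as a formal power series. -/
noncomputable def taylorPowerSeries (φ : 𝕜 → 𝕜) : PowerSeries 𝕜 :=
  PowerSeries.mk fun r => iteratedDeriv r φ 0 / (r.factorial : 𝕜)

theorem taylorPowerSeries_mul [CharZero 𝕜] {φ ψ : 𝕜 → 𝕜} (hφ : ContDiffAt 𝕜 ∞ φ 0)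
    (hψ : ContDiffAt 𝕜 ∞ ψ 0) :
    taylorPowerSeries (fun t => φ t * ψ t) = taylorPowerSeries φ * taylorPowerSeries ψ := by
  ext r
  rw [PowerSeries.coeff_mul, taylorPowerSeries, PowerSeries.coeff_mk,
    iteratedDeriv_fun_mul (hφ.of_le (mod_cast le_top)) (hψ.of_le (mod_cast le_top)),
    Finset.Nat.sum_antidiagonal_eq_sum_range_succ_mk, Finset.sum_div]
  refine Finset.sum_congr rfl fun i hi => ?_
  have hi' : i ≤ r := Nat.lt_succ_iff.1 (Finset.mem_range.1 hi)
  simp only [taylorPowerSeries, PowerSeries.coeff_mk]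
  rw [Nat.cast_choose 𝕜 hi']
  have h1 : (r.factorial : 𝕜) ≠ 0 := Nat.cast_ne_zero.2 (Nat.factorial_ne_zero _)
  have h2 : (i.factorial : 𝕜) ≠ 0 := Nat.cast_ne_zero.2 (Nat.factorial_ne_zero _)
  have h3 : ((r - i).factorial : 𝕜) ≠ 0 := Nat.cast_ne_zero.2 (Nat.factorial_ne_zero _)
  field_simp

theorem taylorPowerSeries_congr {φ ψ : 𝕜 → 𝕜} (h : φ =ᶠ[𝓝 0] ψ) :
    taylorPowerSeries φ = taylorPowerSeries ψ := by
  ext r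
  simp only [taylorPowerSeries, PowerSeries.coeff_mk]
  rw [h.iteratedDeriv_eq]

theorem taylorPowerSeries_deriv [CharZero 𝕜] (φ : 𝕜 → 𝕜) :
    taylorPowerSeries (deriv φ) = PowerSeries.derivative 𝕜 (taylorPowerSeries φ) := by
  ext r
  rw [PowerSeries.coeff_derivative]
  simp only [taylorPowerSeries, PowerSeries.coeff_mk]
  rw [← iteratedDeriv_succ', Nat.factorial_succ]
  have h1 : (r.factorial : 𝕜) ≠ 0 := Nat.cast_ne_zero.2 (Nat.factorial_ne_zero _)
  have h2 : (r : 𝕜) + 1 ≠ 0 := Nat.cast_add_one_ne_zero r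
  push_cast
  field_simp

theorem iteratedDeriv_polynomial_eval (P : Polynomial 𝕜) (r : ℕ) :
    iteratedDeriv r (fun t => P.eval t) = fun t => (Polynomial.derivative^[r] P).eval t := by
  induction r with
  | zero => simp
  | succ r ih =>
    rw [iteratedDeriv_succ, ih, Function.iterate_succ_apply']
    funext t
    exact Polynomial.deriv _

theorem taylorPowerSeries_polynomial [CharZero 𝕜] (P : Polynomial 𝕜) :
    taylorPowerSeries (fun t => P.eval t) = (P : PowerSeries 𝕜) := by
  ext r
  simp only [taylorPowerSeries, PowerSeries.coeff_mk]
  rw [iteratedDeriv_polynomial_eval]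
  beta_reduce
  rw [← Polynomial.coeff_zero_eq_eval_zero,
    Polynomial.coeff_iterate_derivative, Polynomial.coeff_coe]
  have h1 : (r.factorial : 𝕜) ≠ 0 := Nat.cast_ne_zero.2 (Nat.factorial_ne_zero _)
  simp [Nat.descFactorial_self, h1]

theorem taylorPowerSeries_polynomial_mul [CharZero 𝕜] (P : Polynomial 𝕜) {φ : 𝕜 → 𝕜}
    (hφ : ContDiffAt 𝕜 ∞ φ 0) :
    taylorPowerSeries (fun t => P.eval t * φ t) = (P : PowerSeries 𝕜) * taylorPowerSeries φ := by
  have hP : ContDiffAt 𝕜 ∞ (fun t => P.eval t) 0 := by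
    simpa [Polynomial.aeval_def] using (P.contDiff_aeval ∞ (𝕜 := 𝕜) (R := 𝕜)).contDiffAt
  rw [taylorPowerSeries_mul hP hφ, taylorPowerSeries_polynomial]

theorem ContDiffAt.deriv_smooth {φ : 𝕜 → 𝕜} {t : 𝕜} (hφ : ContDiffAt 𝕜 ∞ φ t) :
    ContDiffAt 𝕜 ∞ (deriv φ) t := by
  have := hφ.fderiv_right (m := ∞) (by simp)
  exact this.clm_apply contDiffAt_const

/-- A linear differential equation of first order gives an identity of Taylor series. -/
theorem taylorPowerSeries_ode [CharZero 𝕜] {U W : Polynomial 𝕜} {φ : 𝕜 → 𝕜} (hφ : ContDiffAt 𝕜 ∞ φ 0)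
    (h : ∀ᶠ t in 𝓝 0, U.eval t * deriv φ t = W.eval t * φ t) :
    (U : PowerSeries 𝕜) * PowerSeries.derivative 𝕜 (taylorPowerSeries φ) =
      W * taylorPowerSeries φ := by
  rw [← taylorPowerSeries_deriv, ← taylorPowerSeries_polynomial_mul U hφ.deriv_smooth,
    ← taylorPowerSeries_polynomial_mul W hφ]
  exact taylorPowerSeries_congr h

end TaylorSeries

theorem eq_of_taylorPowerSeries_eq {φ ψ : ℂ → ℂ} {R : ℝ}
    (hφ : DifferentiableOn ℂ φ (Metric.ball 0 R)) (hψ : DifferentiableOn ℂ ψ (Metric.ball 0 R))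
    (h : taylorPowerSeries φ = taylorPowerSeries ψ) {z : ℂ} (hz : z ∈ Metric.ball 0 R) :
    φ z = ψ z := by
  refine (Complex.hasSum_taylorSeries_on_ball hφ hz).unique ?_
  convert Complex.hasSum_taylorSeries_on_ball hψ hz using 2 with r
  have h1 := congrArg (PowerSeries.coeff r) h
  have h2 : (r.factorial : ℂ) ≠ 0 := Nat.cast_ne_zero.2 (Nat.factorial_ne_zero _)
  simp only [taylorPowerSeries, PowerSeries.coeff_mk] at h1
  rw [div_left_inj' h2] at h1
  rw [h1]

/-- An identity of Taylor series gives a differential equation on the disc of convergence. -/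
theorem ode_of_taylorPowerSeries {U W : Polynomial ℂ} {g : ℂ → ℂ} {R : ℝ}
    (hg : DifferentiableOn ℂ g (Metric.ball 0 R))
    (h : (U : PowerSeries ℂ) * PowerSeries.derivative ℂ (taylorPowerSeries g) =
      W * taylorPowerSeries g) {z : ℂ} (hz : z ∈ Metric.ball 0 R) :
    U.eval z * deriv g z = W.eval z * g z := by
  have hR : 0 < R := Metric.pos_of_mem_ball hz
  have hg0 : ContDiffAt ℂ ∞ g 0 :=
    (hg.analyticAt (Metric.ball_mem_nhds 0 hR)).contDiffAt
  refine eq_of_taylorPowerSeries_eq (R := R) (φ := fun z => U.eval z * deriv g z)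
    (ψ := fun z => W.eval z * g z) (U.differentiable.differentiableOn.mul
    (hg.deriv Metric.isOpen_ball)) (W.differentiable.differentiableOn.mul hg) ?_ hz
  rw [taylorPowerSeries_polynomial_mul U hg0.deriv_smooth, taylorPowerSeries_deriv, h,
    taylorPowerSeries_polynomial_mul W hg0]

/-- A power series with coefficients of geometric growth is a Taylor series. -/
theorem exists_taylorPowerSeries_eq_mk {a : ℕ → ℂ} {R M : ℝ} (hR : 0 < R)
    (ha : ∀ r, ‖a r‖ * R ^ r ≤ M) :
    ∃ g : ℂ → ℂ, DifferentiableOn ℂ g (Metric.ball 0 R) ∧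
      taylorPowerSeries g = PowerSeries.mk a := by
  set p := FormalMultilinearSeries.ofScalars ℂ a with hp
  lift R to NNReal using hR.le
  have hrad : (R : ENNReal) ≤ p.radius := by
    refine p.le_radius_of_bound M fun r => ?_
    rw [hp, FormalMultilinearSeries.ofScalars_norm]
    exact ha r
  have hpos : (0 : ENNReal) < R := by exact_mod_cast hR
  have hball := (p.hasFPowerSeriesOnBall (hpos.trans_le hrad)).mono hpos hrad
  refine ⟨p.sum, ?_, ?_⟩
  · have := hball.differentiableOn
    rwa [Metric.eball_coe] at this
  · ext r
    simp only [taylorPowerSeries, PowerSeries.coeff_mk]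
    have h2 : (r.factorial : ℂ) ≠ 0 := Nat.cast_ne_zero.2 (Nat.factorial_ne_zero _)
    rw [iteratedDeriv_eq_iteratedFDeriv, ← hball.factorial_smul 1 r, hp,
      FormalMultilinearSeries.ofScalars_apply_eq]
    simp [h2]

/-- Comparison of orders of vanishing in `P Q g' = α (Q' P - P' Q) g`. -/
theorem eval_ne_zero_of_ode {P Q : Polynomial ℂ} {α : ℝ} (hα : 0 < α) {g : ℂ → ℂ} {R : ℝ}
    {z : ℂ} (hz : z ∈ Metric.ball 0 R) (hg : DifferentiableOn ℂ g (Metric.ball 0 R))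
    (hg0 : g 0 ≠ 0) (hP : P ≠ 0) (hQz : Q.eval z ≠ 0)
    (hode : ∀ t ∈ Metric.ball (0 : ℂ) R, (P * Q).eval t * deriv g t =
      (Polynomial.C (α : ℂ) * (Q.derivative * P - P.derivative * Q)).eval t * g t) :
    P.eval z ≠ 0 := by
  intro hPz
  have hR : 0 < R := Metric.pos_of_mem_ball hz
  have hgan : AnalyticOnNhd ℂ g (Metric.ball 0 R) := hg.analyticOnNhd Metric.isOpen_ball
  have hnz : ¬ ∀ᶠ t in 𝓝 z, g t = 0 := by
    intro h
    have := hgan.eqOn_zero_of_preconnected_of_eventuallyEq_zero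
      (convex_ball (0 : ℂ) R).isPreconnected hz h
    exact hg0 (this (Metric.mem_ball_self hR))
  obtain ⟨m, k, hk, hkz, hgk⟩ := (hgan z hz).exists_eventuallyEq_pow_smul_nonzero_iff.2 hnz
  obtain ⟨P1, hP1, hP1z⟩ := Polynomial.exists_eq_pow_rootMultiplicity_mul_and_not_dvd P hP z
  set a := P.rootMultiplicity z with ha
  have ha0 : 0 < a := (Polynomial.rootMultiplicity_pos hP).2 hPz
  have hP1e : P1.eval z ≠ 0 := fun h => hP1z (Polynomial.dvd_iff_isRoot.2 h)
  have hkd : ∀ᶠ t in 𝓝 z, DifferentiableAt ℂ k t :=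
    hk.eventually_analyticAt.mono fun t ht => ht.differentiableAt
  -- The extra factor `t - z` lets the formula also cover `m = 0`, without the exponent `m - 1`.
  have hgd : ∀ᶠ t in 𝓝 z, (t - z) * deriv g t =
      (t - z) ^ m * (m * k t + (t - z) * deriv k t) := by
    filter_upwards [hgk.eventually_nhds, hkd] with t ht hkt
    have h1 : deriv g t = deriv (fun t => (t - z) ^ m * k t) t := by
      refine Filter.EventuallyEq.deriv_eq ?_
      exact ht
    have h2 : HasDerivAt (fun t => (t - z) ^ m * k t)
        ((m * (t - z) ^ (m - 1) * 1) * k t + (t - z) ^ m * deriv k t) t :=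
      (((hasDerivAt_id t).sub_const z).pow m).mul hkt.hasDerivAt
    rw [h1, h2.deriv]
    rcases m with _ | m
    · simp
    · simp only [Nat.add_sub_cancel]
      ring
  have hPd : ∀ t, (t - z) * P.derivative.eval t =
      (t - z) ^ a * (a * P1.eval t + (t - z) * P1.derivative.eval t) := by
    intro t
    obtain ⟨b, hb⟩ := Nat.exists_eq_succ_of_ne_zero ha0.ne'
    conv_lhs => rw [hP1]
    rw [hb]
    simp [Polynomial.derivative_mul, Polynomial.derivative_pow]
    ring
  have hPt : ∀ t, P.eval t = (t - z) ^ a * P1.eval t := by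
    intro t
    conv_lhs => rw [hP1]
    simp
  -- `H` is the equation multiplied by `t - z` and divided by `(t - z)^(a + m)`. It vanishes near
  -- `z` off `z`, hence at `z` by continuity, where its value is a nonzero multiple of `m + αa`.
  set H : ℂ → ℂ := fun t => P1.eval t * Q.eval t * (m * k t + (t - z) * deriv k t) -
    α * ((t - z) * (Q.derivative.eval t * P1.eval t) -
      (a * P1.eval t + (t - z) * P1.derivative.eval t) * Q.eval t) * k t with hH
  have hHz : ∀ᶠ t in 𝓝[≠] z, H t = 0 := by
    filter_upwards [nhdsWithin_le_nhds hgd, nhdsWithin_le_nhds hgk, self_mem_nhdsWithin,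
      nhdsWithin_le_nhds (Metric.isOpen_ball.mem_nhds hz)] with t h1 h2 h3 h4
    have h5 : (t - z) ^ (a + m) ≠ 0 := pow_ne_zero _ (sub_ne_zero.2 h3)
    refine (mul_eq_zero.1 ?_ : (t - z) ^ (a + m) = 0 ∨ H t = 0).resolve_left h5
    have h6 := hode t h4
    simp only [Polynomial.eval_mul, Polynomial.eval_sub, Polynomial.eval_C] at h6
    have h7 := hPd t
    rw [hPt t, h2, smul_eq_mul] at h6
    rw [hH]
    simp only
    rw [pow_add]
    linear_combination (t - z) * h6 - (t - z) ^ a * P1.eval t * Q.eval t * h1 -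
      α * Q.eval t * ((t - z) ^ m * k t) * h7
  have hHc : ContinuousAt H z := by
    have := hk.continuousAt
    have := hk.deriv.continuousAt
    have h1 := P1.continuous.continuousAt (x := z)
    have h2 := Q.continuous.continuousAt (x := z)
    have h3 := Q.derivative.continuous.continuousAt (x := z)
    have h4 := P1.derivative.continuous.continuousAt (x := z)
    fun_prop
  have hH0 : H z = 0 := by
    refine tendsto_nhds_unique (hHc.tendsto.mono_left nhdsWithin_le_nhds :
      Tendsto H (𝓝[≠] z) _) ?_
    exact tendsto_const_nhds.congr' (hHz.mono fun t ht => ht.symm)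
  have hfac : H z = (P1.eval z * Q.eval z * k z) * ((m + α * a : ℝ) : ℂ) := by
    rw [hH]
    push_cast
    ring
  rw [hfac] at hH0
  have hpos : (0 : ℝ) < m + α * a := by positivity
  exact mul_ne_zero (mul_ne_zero (mul_ne_zero hP1e hQz) hkz)
    (Complex.ofReal_ne_zero.2 hpos.ne') hH0

/-! ### Real Taylor bounds and derivatives along lines. -/

/-- The Taylor coefficients of an absolutely monotone function are bounded by its values. -/
theorem taylor_coeff_mul_pow_le_of_iteratedDeriv_nonneg {φ : ℝ → ℝ} {R : ℝ} (hR : 0 < R)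
    (hφ : ∀ t ∈ Set.Icc 0 R, ContDiffAt ℝ ∞ φ t)
    (h : ∀ r, ∀ t ∈ Set.Icc 0 R, 0 ≤ iteratedDeriv r φ t) (r : ℕ) :
    iteratedDeriv r φ 0 / r.factorial * R ^ r ≤ φ R := by
  have h0 : (0 : ℝ) ∈ Set.Icc 0 R := ⟨le_rfl, hR.le⟩
  obtain ⟨x, hx, hxe⟩ := taylor_mean_remainder_lagrange_iteratedDeriv (f := φ) (n := r) hR.ne
    (fun t ht => by
      rw [Set.uIcc_of_le hR.le] at ht
      exact ((hφ t ht).of_le (mod_cast le_top)).contDiffWithinAt)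
  rw [Set.uIoo_of_lt hR] at hx
  rw [Set.uIcc_of_le hR.le] at hxe
  -- The Lagrange remainder and all Taylor terms are nonnegative, so each single term is at most `φ
  -- R`.
  have hrem : 0 ≤ iteratedDeriv (r + 1) φ x * (R - 0) ^ (r + 1) / ((r + 1).factorial : ℝ) := by
    have := h (r + 1) x (Set.Ioo_subset_Icc_self hx)
    rw [sub_zero]
    positivity
  rw [← hxe, taylor_within_apply] at hrem
  have hsum : iteratedDeriv r φ 0 / r.factorial * R ^ r ≤
      ∑ k ∈ Finset.range (r + 1), ((k.factorial : ℝ)⁻¹ * (R - 0) ^ k) •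
        iteratedDerivWithin k φ (Set.Icc 0 R) 0 := by
    have hk : ∀ k, ((k.factorial : ℝ)⁻¹ * (R - 0) ^ k) •
        iteratedDerivWithin k φ (Set.Icc 0 R) 0 = iteratedDeriv k φ 0 / k.factorial * R ^ k := by
      intro k
      rw [iteratedDerivWithin_eq_iteratedDeriv (uniqueDiffOn_Icc hR)
        ((hφ 0 h0).of_le (mod_cast le_top)) h0, smul_eq_mul, sub_zero]
      ring
    simp only [hk]
    refine Finset.single_le_sum (f := fun k => iteratedDeriv k φ 0 / k.factorial * R ^ k)
      (fun k _ => ?_) (Finset.self_mem_range_succ r)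
    have := h k 0 h0
    positivity
  linarith

theorem iteratedDeriv_comp_line {E : Type*} [NormedAddCommGroup E] [NormedSpace ℝ E]
    {f : E → ℝ} {s : Set E} (hs : IsOpen s) (hf : ContDiffOn ℝ ∞ f s) (x w : E) (r : ℕ) :
    ∀ t : ℝ, x + t • w ∈ s → iteratedDeriv r (fun t : ℝ => f (x + t • w)) t =
      iteratedFDeriv ℝ r f (x + t • w) fun _ => w := by
  induction r with
  | zero => intro t _; simp
  | succ r ih =>
    intro t ht
    have hcont : Continuous fun t : ℝ => x + t • w := by fun_prop
    rw [iteratedDeriv_succ, Filter.EventuallyEq.deriv_eq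
      (f := fun t : ℝ => iteratedFDeriv ℝ r f (x + t • w) fun _ => w)
      ((hcont.continuousAt.eventually_mem (hs.mem_nhds ht)).mono fun u hu => ih u hu)]
    have hd : DifferentiableAt ℝ (iteratedFDeriv ℝ r f) (x + t • w) :=
      ((hf.contDiffAt (hs.mem_nhds ht)).iteratedFDeriv_right (m := 1) (i := r)
        (mod_cast le_top)).differentiableAt (by simp)
    have hl : HasDerivAt (fun t : ℝ => x + t • w) w t := by
      simpa using ((hasDerivAt_id t).smul_const w).const_add x
    have h1 := hd.hasFDerivAt.comp_hasDerivAt t hl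
    have h2 := ((ContinuousMultilinearMap.apply ℝ (fun _ : Fin r => E) ℝ
      (fun _ => w)).hasFDerivAt).comp_hasDerivAt t h1
    have h3 := h2.deriv
    simp only [Function.comp_def, ContinuousMultilinearMap.apply_apply] at h3
    rw [h3, iteratedFDeriv_succ_apply_left]
    rfl

/-! ### Taylor coefficients as polynomials in the direction. -/

section Coefficients

variable {E : Type*} [NormedAddCommGroup E] [NormedSpace ℝ E] {ι : Type*} [Fintype ι]

/-- The `r`-th Taylor coefficient at `0` of `t ↦ f (x + t ∑ⱼ cⱼ vⱼ)`, as a polynomial in `c`. -/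
noncomputable def lineTaylorCoeff (f : E → ℝ) (x : E) (v : ι → E) (r : ℕ) : MvPolynomial ι ℝ :=
  ∑ s : Fin r → ι, MvPolynomial.C (iteratedFDeriv ℝ r f x (fun i => v (s i)) / r.factorial) *
    ∏ i, MvPolynomial.X (s i)

theorem iteratedFDeriv_sum_smul (f : E → ℝ) (x : E) (v : ι → E) (r : ℕ) (c : ι → ℝ) :
    iteratedFDeriv ℝ r f x (fun _ => ∑ j, c j • v j) =
      ∑ s : Fin r → ι, (∏ i, c (s i)) * iteratedFDeriv ℝ r f x (fun i => v (s i)) := by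
  classical
  rw [ContinuousMultilinearMap.map_sum]
  refine Finset.sum_congr rfl fun s _ => ?_
  rw [ContinuousMultilinearMap.map_smul_univ, smul_eq_mul]

theorem eval_lineTaylorCoeff (f : E → ℝ) (x : E) (v : ι → E) (r : ℕ) (c : ι → ℝ) :
    MvPolynomial.eval c (lineTaylorCoeff f x v r) =
      iteratedFDeriv ℝ r f x (fun _ => ∑ j, c j • v j) / r.factorial := by
  rw [iteratedFDeriv_sum_smul, Finset.sum_div, lineTaylorCoeff, map_sum]
  refine Finset.sum_congr rfl fun s _ => ?_
  simp
  ring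

/-- The triangle inequality loses nothing on the derivatives: their common sign `(-1)^r` lets the
absolute values be recombined into one derivative in direction `∑ ‖cⱼ‖ vⱼ`. -/
theorem norm_aeval_lineTaylorCoeff_le {f : E → ℝ} {x : E} {v : ι → E} {r : ℕ}
    (h : ∀ s : Fin r → ι, 0 ≤ (-1) ^ r * iteratedFDeriv ℝ r f x (fun i => v (s i)))
    (c : ι → ℂ) :
    ‖MvPolynomial.aeval c (lineTaylorCoeff f x v r)‖ ≤
      (-1) ^ r * iteratedFDeriv ℝ r f x (fun _ => ∑ j, ‖c j‖ • v j) / r.factorial := by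
  rw [iteratedFDeriv_sum_smul, Finset.mul_sum, Finset.sum_div, lineTaylorCoeff, map_sum]
  refine (norm_sum_le _ _).trans (Finset.sum_le_sum fun s _ => ?_)
  have h1 : |iteratedFDeriv ℝ r f x (fun i => v (s i))| =
      (-1) ^ r * iteratedFDeriv ℝ r f x (fun i => v (s i)) := by
    rw [← abs_of_nonneg (h s), abs_mul, abs_pow, abs_neg, abs_one, one_pow, one_mul]
  simp only [map_mul, map_prod, MvPolynomial.aeval_X, MvPolynomial.aeval_C, norm_mul, norm_prod,
    Complex.coe_algebraMap, Complex.norm_real, Real.norm_eq_abs, abs_div, h1, Nat.abs_cast]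
  apply le_of_eq
  ring

end Coefficients

/-! ### The differential equation of `(q / p) ^ α` on real and complex lines. -/

section PowerODE

variable {n : ℕ} {p q : MvPolynomial (Fin n) ℝ}

theorem aeval_real_eq_eval {σ : Type*} (x : σ → ℝ) (p : MvPolynomial σ ℝ) :
    MvPolynomial.aeval x p = MvPolynomial.eval x p :=
  DFunLike.congr_fun (MvPolynomial.coe_aeval_eq_eval x) p

theorem eval_lineRestrict_real (p : MvPolynomial (Fin n) ℝ) (x w : Fin n → ℝ) (t : ℝ) :
    (p.lineRestrict x w).eval t = MvPolynomial.eval (x + t • w) p := by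
  rw [MvPolynomial.eval_lineRestrict, aeval_real_eq_eval]
  rfl

/-- The polynomial `α (Q' P - P' Q)`. -/
noncomputable def odeRhs {S : Type*} [CommRing S] (a : S) (P Q : Polynomial S) : Polynomial S :=
  Polynomial.C a * (Q.derivative * P - P.derivative * Q)

theorem map_odeRhs {S T : Type*} [CommRing S] [CommRing T] (φ : S →+* T) (a : S)
    (P Q : Polynomial S) :
    (odeRhs a P Q).map φ = odeRhs (φ a) (P.map φ) (Q.map φ) := by
  simp [odeRhs, Polynomial.derivative_map]

/-- Logarithmic differentiation, cleared of denominators so that the coefficients are polynomials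
and the equation keeps its meaning at zeros of `P`. -/
theorem deriv_rpow_div {P Q : Polynomial ℝ} {α t : ℝ} (hP : 0 < P.eval t) (hQ : 0 < Q.eval t) :
    (P * Q).eval t * deriv (fun t => (Q.eval t / P.eval t) ^ α) t =
      (odeRhs α P Q).eval t * (Q.eval t / P.eval t) ^ α := by
  have hd := ((Q.hasDerivAt t).div (P.hasDerivAt t) hP.ne').rpow_const (p := α)
    (Or.inl (div_pos hQ hP).ne')
  have hd' := hd.deriv
  simp only [Pi.div_apply] at hd'
  rw [hd', Real.rpow_sub_one (div_pos hQ hP).ne']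
  simp only [odeRhs, Polynomial.eval_mul, Polynomial.eval_sub, Polynomial.eval_C]
  have := hP.ne'
  have := hQ.ne'
  field_simp

theorem taylorPowerSeries_rpow_div_line {s : Set (Fin n → ℝ)} (hs : IsOpen s)
    (hp : ∀ x ∈ s, 0 < MvPolynomial.eval x p) (hq : ∀ x ∈ s, 0 < MvPolynomial.eval x q) {α : ℝ}
    (hf : ContDiffOn ℝ ∞
      (fun x => (MvPolynomial.eval x q / MvPolynomial.eval x p) ^ α) s)
    {x : Fin n → ℝ} (hx : x ∈ s) (w : Fin n → ℝ) :
    ((p.lineRestrict x w * q.lineRestrict x w : Polynomial ℝ) : PowerSeries ℝ) *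
      PowerSeries.derivative ℝ (PowerSeries.mk fun r => iteratedFDeriv ℝ r
        (fun x => (MvPolynomial.eval x q / MvPolynomial.eval x p) ^ α) x (fun _ => w) /
          (r.factorial : ℝ)) =
    (odeRhs α (p.lineRestrict x w) (q.lineRestrict x w) : PowerSeries ℝ) *
      PowerSeries.mk fun r => iteratedFDeriv ℝ r
        (fun x => (MvPolynomial.eval x q / MvPolynomial.eval x p) ^ α) x (fun _ => w) /
          (r.factorial : ℝ) := by
  set f : (Fin n → ℝ) → ℝ :=
    fun x => (MvPolynomial.eval x q / MvPolynomial.eval x p) ^ α with hfdef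
  have hx0 : x + (0 : ℝ) • w ∈ s := by simpa using hx
  have hT : (PowerSeries.mk fun r => iteratedFDeriv ℝ r f x (fun _ => w) / (r.factorial : ℝ)) =
      taylorPowerSeries fun t : ℝ => f (x + t • w) := by
    ext r
    simp only [taylorPowerSeries, PowerSeries.coeff_mk]
    rw [iteratedDeriv_comp_line hs hf x w r 0 hx0, zero_smul, add_zero]
  have hc : Continuous fun t : ℝ => x + t • w := by fun_prop
  rw [hT]
  apply taylorPowerSeries_ode
  · have h1 : ContDiffAt ℝ ∞ f (x + (0 : ℝ) • w) := hf.contDiffAt (hs.mem_nhds hx0)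
    exact h1.comp (0 : ℝ) (f := fun t : ℝ => x + t • w) (by fun_prop)
  · filter_upwards [hc.continuousAt.eventually_mem (hs.mem_nhds hx0)] with t ht
    have h1 := hp _ ht
    have h2 := hq _ ht
    simp only [hfdef, ← eval_lineRestrict_real] at h1 h2 ⊢
    exact deriv_rpow_div h1 h2

/-- The differential equation for the Taylor coefficients of `(q / p) ^ α` holds identically in the
direction `∑ⱼ cⱼ vⱼ`, hence also for complex `c`. -/
theorem aeval_lineTaylorCoeff_ode {ι : Type*} [Fintype ι] {s : Set (Fin n → ℝ)} (hs : IsOpen s)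
    (hp : ∀ x ∈ s, 0 < MvPolynomial.eval x p) (hq : ∀ x ∈ s, 0 < MvPolynomial.eval x q) {α : ℝ}
    (hf : ContDiffOn ℝ ∞
      (fun x => (MvPolynomial.eval x q / MvPolynomial.eval x p) ^ α) s)
    {x : Fin n → ℝ} (hx : x ∈ s) (v : ι → Fin n → ℝ) (c : ι → ℂ) (P Q : Polynomial ℂ)
    (hP : P = p.lineRestrict (fun i => (x i : ℂ)) fun i => ∑ j, c j * (v j i : ℂ))
    (hQ : Q = q.lineRestrict (fun i => (x i : ℂ)) fun i => ∑ j, c j * (v j i : ℂ)) :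
    ((P * Q : Polynomial ℂ) : PowerSeries ℂ) *
      PowerSeries.derivative ℂ (PowerSeries.mk fun r => MvPolynomial.aeval c (lineTaylorCoeff
        (fun x => (MvPolynomial.eval x q / MvPolynomial.eval x p) ^ α) x v r)) =
    (odeRhs (α : ℂ) P Q : PowerSeries ℂ) *
      PowerSeries.mk fun r => MvPolynomial.aeval c (lineTaylorCoeff
        (fun x => (MvPolynomial.eval x q / MvPolynomial.eval x p) ^ α) x v r) := by
  set f : (Fin n → ℝ) → ℝ :=
    fun x => (MvPolynomial.eval x q / MvPolynomial.eval x p) ^ α with hfdef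
  let a : Fin n → MvPolynomial ι ℝ := fun i => MvPolynomial.C (x i)
  let b : Fin n → MvPolynomial ι ℝ :=
    fun i => ∑ j, MvPolynomial.X j * MvPolynomial.C (v j i)
  -- Both sides live over `MvPolynomial ι ℝ` with `c` as indeterminates. Specialization to every
  -- real `d` shows that their difference is zero; specialization to the complex `c` then gives the
  -- claim.
  have hmap : ∀ {A : Type} [CommRing A] [Algebra ℝ A] (φ : MvPolynomial ι ℝ →ₐ[ℝ] A),
      PowerSeries.map (φ : MvPolynomial ι ℝ →+* A)
        (((p.lineRestrict a b * q.lineRestrict a b : Polynomial _) : PowerSeries _) *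
          PowerSeries.derivative _ (PowerSeries.mk (lineTaylorCoeff f x v)) -
        (odeRhs (MvPolynomial.C α) (p.lineRestrict a b) (q.lineRestrict a b) : PowerSeries _) *
          PowerSeries.mk (lineTaylorCoeff f x v)) =
      ((p.lineRestrict (φ ∘ a) (φ ∘ b) * q.lineRestrict (φ ∘ a) (φ ∘ b) : Polynomial A) :
          PowerSeries A) *
          PowerSeries.derivative _ (PowerSeries.mk fun r => φ (lineTaylorCoeff f x v r)) -
        (odeRhs (algebraMap ℝ A α) (p.lineRestrict (φ ∘ a) (φ ∘ b))
          (q.lineRestrict (φ ∘ a) (φ ∘ b)) : PowerSeries A) *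
          PowerSeries.mk fun r => φ (lineTaylorCoeff f x v r) := by
    intro A _ _ φ
    have h1 : PowerSeries.map (φ : MvPolynomial ι ℝ →+* A)
        (PowerSeries.mk (lineTaylorCoeff f x v)) =
        PowerSeries.mk fun r => φ (lineTaylorCoeff f x v r) := by
      ext r
      simp
    have h2 : PowerSeries.map (φ : MvPolynomial ι ℝ →+* A)
        (PowerSeries.derivative _ (PowerSeries.mk (lineTaylorCoeff f x v))) =
        PowerSeries.derivative _ (PowerSeries.mk fun r => φ (lineTaylorCoeff f x v r)) := by
      ext r
      simp [PowerSeries.coeff_derivative]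
    have h3 : φ (MvPolynomial.C α) = algebraMap ℝ A α := φ.commutes α
    rw [map_sub, map_mul, map_mul, h1, h2, ← Polynomial.polynomial_map_coe,
      ← Polynomial.polynomial_map_coe, map_odeRhs, Polynomial.map_mul,
      MvPolynomial.map_lineRestrict, MvPolynomial.map_lineRestrict, ← h3]
    rfl
  have hzero : ((p.lineRestrict a b * q.lineRestrict a b : Polynomial _) : PowerSeries _) *
          PowerSeries.derivative _ (PowerSeries.mk (lineTaylorCoeff f x v)) -
        (odeRhs (MvPolynomial.C α) (p.lineRestrict a b) (q.lineRestrict a b) : PowerSeries _) *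
          PowerSeries.mk (lineTaylorCoeff f x v) = 0 := by
    ext1 r
    refine MvPolynomial.funext fun d => ?_
    have h1 := hmap (MvPolynomial.aeval d : MvPolynomial ι ℝ →ₐ[ℝ] ℝ)
    have ha : (MvPolynomial.aeval d : MvPolynomial ι ℝ →ₐ[ℝ] ℝ) ∘ a = x := by
      funext i
      simp [a]
    have hb : (MvPolynomial.aeval d : MvPolynomial ι ℝ →ₐ[ℝ] ℝ) ∘ b = ∑ j, d j • v j := by
      funext i
      simp [b]
    have hc : ∀ r, MvPolynomial.aeval d (lineTaylorCoeff f x v r) =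
        iteratedFDeriv ℝ r f x (fun _ => ∑ j, d j • v j) / (r.factorial : ℝ) := by
      intro r
      rw [aeval_real_eq_eval]
      exact eval_lineTaylorCoeff f x v r d
    simp only [ha, hb, hc, Algebra.algebraMap_self_apply] at h1
    rw [sub_eq_zero.2 (taylorPowerSeries_rpow_div_line hs hp hq hf hx _)] at h1
    have h2 := congrArg (PowerSeries.coeff r) h1
    rw [PowerSeries.coeff_map] at h2
    simpa only [map_zero, RingHom.coe_coe, aeval_real_eq_eval] using h2
  have h1 := hmap (MvPolynomial.aeval c : MvPolynomial ι ℝ →ₐ[ℝ] ℂ)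
  rw [hzero, map_zero] at h1
  have ha : (MvPolynomial.aeval c : MvPolynomial ι ℝ →ₐ[ℝ] ℂ) ∘ a = fun i => (x i : ℂ) := by
    funext i
    simp [a]
  have hb : (MvPolynomial.aeval c : MvPolynomial ι ℝ →ₐ[ℝ] ℂ) ∘ b =
      fun i => ∑ j, c j * (v j i : ℂ) := by
    funext i
    simp [b]
  rw [ha, hb, ← hP, ← hQ] at h1
  exact sub_eq_zero.1 h1.symm

end PowerODE

/-! ### Absence of zeros in the tube over the cone. -/

section Tube

variable {n : ℕ} {p q : MvPolynomial (Fin n) ℝ}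

/-- The function `s ↦ f(s e)` bounds the Taylor coefficients of a completely monotone function. -/
theorem IsCompletelyMonotoneOn.taylor_coeff_ray_le {f : (Fin n → ℝ) → ℝ}
    {C : ConvexCone ℝ (Fin n → ℝ)} (hCo : IsOpen (C : Set (Fin n → ℝ)))
    (hf : IsCompletelyMonotoneOn f C) {e : Fin n → ℝ} (he : e ∈ C) {a b R : ℝ} (hb : 0 < b)
    (hR : 0 < R) (hab : R * b < a) (r : ℕ) :
    (-1) ^ r * iteratedFDeriv ℝ r f (a • e) (fun _ => b • e) / r.factorial * R ^ r ≤
      f ((a - R * b) • e) := by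
  have hmem : ∀ t ∈ Set.Icc 0 R, a • e + t • (-b) • e ∈ C := by
    intro t ht
    rw [smul_smul, ← add_smul]
    refine C.smul_mem ?_ he
    nlinarith [ht.2]
  -- Moving in direction `-b e` absorbs the sign `(-1)^r`, making the restriction absolutely
  -- monotone; `R b < a` keeps the segment inside `C`.
  have hsign : ∀ r : ℕ, ∀ t ∈ Set.Icc 0 R,
      iteratedDeriv r (fun t : ℝ => f (a • e + t • (-b) • e)) t =
        (-1) ^ r * iteratedFDeriv ℝ r f (a • e + t • (-b) • e) (fun _ => b • e) := by
    intro r t ht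
    rw [iteratedDeriv_comp_line hCo hf.1 _ _ r t (hmem t ht)]
    have : (fun _ : Fin r => (-b) • e) = fun i => (fun _ => (-1 : ℝ)) i • (fun _ => b • e) i := by
      funext i
      simp
    rw [this, ContinuousMultilinearMap.map_smul_univ]
    simp
  have h := taylor_coeff_mul_pow_le_of_iteratedDeriv_nonneg hR
    (φ := fun t : ℝ => f (a • e + t • (-b) • e)) (fun t ht => by
      have h1 := hf.1.contDiffAt (hCo.mem_nhds (hmem t ht))
      exact h1.comp t (f := fun t : ℝ => a • e + t • (-b) • e) (by fun_prop))
    (fun r t ht => by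
      rw [hsign r t ht]
      exact hf.2 r _ (fun _ => C.smul_mem hb he) _ (hmem t ht)) r
  rw [hsign r 0 ⟨le_rfl, hR.le⟩, zero_smul, add_zero] at h
  refine h.trans (le_of_eq ?_)
  congr 1
  rw [smul_smul, ← add_smul]
  congr 1
  ring

theorem exists_pos_smul_mem {C : Set (Fin n → ℝ)} (hCo : IsOpen C) {e : Fin n → ℝ} (he : e ∈ C)
    (y : Fin n → ℝ) : ∃ δ : ℝ, 0 < δ ∧ e + δ • y ∈ C ∧ e - δ • y ∈ C := by
  have h1 : ContinuousAt (fun δ : ℝ => e + δ • y) 0 := by fun_prop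
  have h2 : ContinuousAt (fun δ : ℝ => e - δ • y) 0 := by fun_prop
  have h3 := (h1.eventually_mem (hCo.mem_nhds (by simpa using he))).and
    (h2.eventually_mem (hCo.mem_nhds (by simpa using he)))
  obtain ⟨δ, h4, h5⟩ := ((h3.filter_mono nhdsWithin_le_nhds).and
    (self_mem_nhdsWithin (a := (0 : ℝ)) (s := Set.Ioi 0))).exists
  exact ⟨δ, h5, h4⟩

/-- If `(q / p) ^ α` is completely monotone, then `p` has no zero in the tube over the cone outside
the zero set of `q`. -/
theorem aeval_tube_ne_zero_of_aeval_ne_zero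
    {C : ConvexCone ℝ (Fin n → ℝ)} (hCo : IsOpen (C : Set (Fin n → ℝ)))
    (hpC : ∀ x ∈ C, 0 < MvPolynomial.eval x p) (hqC : ∀ x ∈ C, 0 < MvPolynomial.eval x q)
    {α : ℝ} (hα : 0 < α)
    (hCM : IsCompletelyMonotoneOn
      (fun x => (MvPolynomial.eval x q / MvPolynomial.eval x p) ^ α) (C : Set (Fin n → ℝ)))
    {z : Fin n → ℂ} (hz : (fun i => (z i).re) ∈ C) (hqz : MvPolynomial.aeval z q ≠ 0) :
    MvPolynomial.aeval z p ≠ 0 := by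
  set f : (Fin n → ℝ) → ℝ :=
    fun x => (MvPolynomial.eval x q / MvPolynomial.eval x p) ^ α with hfdef
  set e : Fin n → ℝ := fun i => (z i).re with he
  set y : Fin n → ℝ := fun i => (z i).im with hy
  obtain ⟨δ, hδ, hu, hv⟩ := exists_pos_smul_mem hCo hz y
  -- The choice gives `1 / (4δ²) = N - 1`, so `ρ² = (N - 1/2)² + N - 1 = N² - 3/4 < N²`. The `c`
  -- below satisfy `∑ cⱼ vⱼ = (1 - 2N) e + i y`, so that `2N e + ∑ cⱼ vⱼ = z`.
  set N : ℝ := 1 + 1 / (4 * δ ^ 2) with hN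
  have hN1 : 1 < N := by rw [hN]; simpa using by positivity
  set c : Fin 2 → ℂ := ![⟨1 / 2 - N, 1 / (2 * δ)⟩, ⟨1 / 2 - N, -(1 / (2 * δ))⟩] with hc
  set v : Fin 2 → Fin n → ℝ := ![e + δ • y, e - δ • y] with hvdef
  have hvC : ∀ j, v j ∈ C := by
    intro j
    fin_cases j
    · exact hu
    · exact hv
  set ρ : ℝ := ‖c 0‖ with hρ
  have hρ1 : ‖c 1‖ = ρ := by
    simp [hρ, hc, Complex.norm_def, Complex.normSq_apply]
  have hρsq : ρ ^ 2 = (1 / 2 - N) ^ 2 + 1 / (4 * δ ^ 2) := by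
    rw [hρ, Complex.sq_norm, Complex.normSq_apply]
    simp only [hc, Matrix.cons_val_zero]
    field_simp
    ring
  have hρN : ρ < N := by
    refine lt_of_pow_lt_pow_left₀ 2 (by linarith) ?_
    rw [hρsq, show 1 / (4 * δ ^ 2) = N - 1 by rw [hN]; ring]
    nlinarith
  have hρ0 : 0 < ρ := by
    refine lt_of_le_of_ne (norm_nonneg _) fun h => ?_
    have h1 : (0 : ℝ) < 1 / (4 * δ ^ 2) := by positivity
    rw [← h] at hρsq
    nlinarith [sq_nonneg (1 / 2 - N)]
  -- `R > 1` puts the parameter `1` of `z` inside the disc, and `R < N / ρ` keeps `(2N - 2ρR) e` in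
  -- `C`.
  obtain ⟨R, hR1, hR2⟩ := exists_between ((one_lt_div hρ0).2 hρN)
  have hRρ : R * (2 * ρ) < 2 * N := by
    have := (lt_div_iff₀ hρ0).1 hR2
    linarith
  have hR0 : 0 < R := by linarith
  set x : Fin n → ℝ := (2 * N) • e with hx
  have hxC : x ∈ C := C.smul_mem (by linarith) hz
  have hV : ∑ j, ‖c j‖ • v j = (2 * ρ) • e := by
    rw [Fin.sum_univ_two, hρ1, ← hρ]
    funext i
    simp [hvdef]
    ring
  have hbound : ∀ r, ‖MvPolynomial.aeval c (lineTaylorCoeff f x v r)‖ * R ^ r ≤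
      f ((2 * N - R * (2 * ρ)) • e) := by
    intro r
    refine le_trans ?_ (hCM.taylor_coeff_ray_le hCo hz (b := 2 * ρ) (by positivity) hR0 hRρ r)
    refine mul_le_mul_of_nonneg_right ?_ (by positivity)
    rw [← hV]
    exact norm_aeval_lineTaylorCoeff_le (fun s => hCM.2 r _ (fun i => hvC _) x hxC) c
  obtain ⟨g, hg, hgT⟩ := exists_taylorPowerSeries_eq_mk hR0 hbound
  set P : Polynomial ℂ :=
    p.lineRestrict (fun i => (x i : ℂ)) fun i => ∑ j, c j * (v j i : ℂ) with hP
  set Q : Polynomial ℂ :=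
    q.lineRestrict (fun i => (x i : ℂ)) fun i => ∑ j, c j * (v j i : ℂ) with hQ
  have hode := aeval_lineTaylorCoeff_ode hCo hpC hqC hCM.1 hxC v c P Q hP hQ
  rw [← hfdef, ← hgT] at hode
  have hend : (fun i => (x i : ℂ) + 1 * ∑ j, c j * (v j i : ℂ)) = z := by
    funext i
    have hδ' := hδ.ne'
    rw [Fin.sum_univ_two]
    apply Complex.ext
    · simp [hc, hvdef, hx, he]
      ring
    · simp [hc, hvdef, hy]
      field_simp
      ring
  have hP1 : P.eval 1 = MvPolynomial.aeval z p := by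
    rw [hP, MvPolynomial.eval_lineRestrict, hend]
  have hQ1 : Q.eval 1 = MvPolynomial.aeval z q := by
    rw [hQ, MvPolynomial.eval_lineRestrict, hend]
  have hP0 : P.eval 0 ≠ 0 := by
    rw [hP, MvPolynomial.eval_lineRestrict]
    simp only [zero_mul, add_zero]
    have h1 : MvPolynomial.aeval (fun i => algebraMap ℝ ℂ (x i)) p =
        algebraMap ℝ ℂ (MvPolynomial.aeval x p) := MvPolynomial.aeval_algebraMap_apply ℂ x p
    have h2 : MvPolynomial.aeval (fun i => (x i : ℂ)) p = _ := h1
    rw [h2, aeval_real_eq_eval]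
    exact Complex.ofReal_ne_zero.2 (hpC x hxC).ne'
  have hg0 : g 0 ≠ 0 := by
    have h1 := congrArg (PowerSeries.coeff 0) hgT
    simp only [taylorPowerSeries, PowerSeries.coeff_mk, iteratedDeriv_zero, Nat.factorial_zero,
      Nat.cast_one, div_one] at h1
    have h2 : 0 < f x := Real.rpow_pos_of_pos (div_pos (hqC x hxC) (hpC x hxC)) α
    rw [h1]
    simpa [lineTaylorCoeff] using h2.ne'
  rw [← hP1]
  rw [← hQ1] at hqz
  refine eval_ne_zero_of_ode hα (R := R) (by simpa using hR1) hg hg0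
    (fun h => hP0 (by rw [h, Polynomial.eval_zero])) hqz fun t ht => ?_
  exact ode_of_taylorPowerSeries hg hode ht

/-- If `p` and `q` have no common factor and `(q / p) ^ α` is completely monotone, then `p` has no
zero in the tube over the cone. -/
theorem aeval_tube_ne_zero {d : ℕ} (hp : p.IsHomogeneous d) (hpq : IsRelPrime p q)
    {C : ConvexCone ℝ (Fin n → ℝ)} (hCo : IsOpen (C : Set (Fin n → ℝ)))
    (hpC : ∀ x ∈ C, 0 < MvPolynomial.eval x p) (hqC : ∀ x ∈ C, 0 < MvPolynomial.eval x q)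
    {α : ℝ} (hα : 0 < α)
    (hCM : IsCompletelyMonotoneOn
      (fun x => (MvPolynomial.eval x q / MvPolynomial.eval x p) ^ α) (C : Set (Fin n → ℝ)))
    {z : Fin n → ℂ} (hz : (fun i => (z i).re) ∈ C) :
    MvPolynomial.aeval z p ≠ 0 := by
  intro h
  have hcont : Continuous fun z : Fin n → ℂ => fun i => (z i).re := by fun_prop
  obtain ⟨z', hz'U, hz'p, hz'q⟩ := MvPolynomial.exists_zero_ne_zero_near hpq hp
    (hpC _ hz).ne' h ((hCo.preimage hcont).mem_nhds hz)
  exact aeval_tube_ne_zero_of_aeval_ne_zero hCo hpC hqC hα hCM hz'U hz'q hz'p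

end Tube

/-! ### From the tube to hyperbolicity. -/

theorem MvPolynomial.aeval_mul_of_isHomogeneous {σ R : Type*} [CommRing R] [Algebra ℝ R]
    {p : MvPolynomial σ ℝ} {d : ℕ} (hp : p.IsHomogeneous d) (c : R) (z : σ → R) :
    MvPolynomial.aeval (fun i => c * z i) p = c ^ d * MvPolynomial.aeval z p := by
  rw [aeval_def, aeval_def, eval₂_eq, eval₂_eq, Finset.mul_sum]
  refine Finset.sum_congr rfl fun m hm => ?_
  simp only [mul_pow, Finset.prod_mul_distrib, Finset.prod_pow_eq_pow_sum,
    sum_support_of_isHomogeneous hp hm]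
  ring

theorem mainTheorem2 (n : ℕ) (p q : MvPolynomial (Fin n) ℝ)
    (hp : ∃ d : ℕ, p.IsHomogeneous d) (hq : ∃ d : ℕ, q.IsHomogeneous d)
    (hpq : IsRelPrime p q)
    (C : ConvexCone ℝ (Fin n → ℝ)) (hCo : IsOpen (C : Set (Fin n → ℝ)))
    (hCne : (C : Set (Fin n → ℝ)).Nonempty)
    (hpC : ∀ x ∈ C, 0 < MvPolynomial.eval x p) (hqC : ∀ x ∈ C, 0 < MvPolynomial.eval x q)
    (α : ℝ) (hα : 0 < α)
    (hCM : IsCompletelyMonotoneOn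
      (fun x => (MvPolynomial.eval x q / MvPolynomial.eval x p) ^ α) (C : Set (Fin n → ℝ))) :
    IsHyperbolic p ∧
      ∀ e ∈ C, IsHyperbolicWrt p e ∧ (C : Set (Fin n → ℝ)) ⊆ hyperbolicityCone p e := by
  obtain ⟨d, hd⟩ := hp
  have hhyp : ∀ e ∈ C, IsHyperbolicWrt p e := by
    intro e he
    refine ⟨⟨d, hd⟩, hpC e he, fun x t ht => ?_⟩
    by_contra him
    -- Multiplication by `-i / Im t` turns `t e + x` into a point with real part `e`, since `e` and
    -- `x` are real.
    refine aeval_tube_ne_zero hd hpq hCo hpC hqC hα hCM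
      (z := fun i => (-Complex.I * ((t.im)⁻¹ : ℝ)) * (t * (e i : ℂ) + (x i : ℂ))) ?_ ?_
    · convert he using 1
      funext i
      simp [him]
    · rw [MvPolynomial.aeval_mul_of_isHomogeneous hd, ht, mul_zero]
  refine ⟨hCne.imp fun e he => hhyp e he, fun e he => ⟨hhyp e he, ?_⟩⟩
  -- `C` is convex, hence connected, and `p` does not vanish on it.
  exact C.convex.isPreconnected.subset_connectedComponentIn he fun x hx => (hpC x hx).ne'
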